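/- **Definitions.** A *network* $G=(V,E,\ell)$ is an undirected graph $(V,E)$ (loops allowed) with a non-negative integer label $\ell(u,v)$ for every ordered pair with $\{u,v\}\in E$; an *automorphism* is a permutation of $V$ preserving adjacencies and labels. Let $\mathbb N_n=\{0,\dots,n-1\}$. An *arrangement* of $k\ge 1$ robots is a map $a:\mathbb N_k\to V$. Arrangements $a_1,a_2$ are *equivalent under* an automorphism $\alpha$ and a permutation $\pi$ of $\mathbb N_k$ if $\alpha\circ a_1=a_2\circ\pi$. A *configuration* is an equivalence class of arrangements, and $\mathcal C(G,k)$ is the set of configurations. Vertices $v,w$ are *equivalent in* $a$ if $\alpha(v)=w$ for some $\alpha,\pi$ under which $a$ is equivalent to itself. A *class of indistinguishable vertices* $U$ of a configuration $C$ assigns to each $a\in C$ an equivalence class $U_a$ of vertices of $a$, such that $\alpha(U_{a_1})=U_{a_2}$ whenever $a_1,a_2\in C$ are equivalent under $\alpha,\pi$. An *algorithm* $A$ maps each pair $(C,U)$, with $C\in\mathcal C(G,k)$ and $U$ a class of indistinguishable vertices of $C$, to a class $A(C,U)$ of indistinguishable vertices of $C$ such that for all $a\in C$ and $u\in U_a$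 some $u'\in A(C,U)_a$ is equal or adjacent to $u$. It is *sequential* if it never instructs two robots to move at the same time: for every $C$ and $a\in C$ there is at most one robot $r$ such that, for the class $U$ with $a(r)\in U_a$, the set $A(C,U)_a$ contains a vertex adjacent to and different from $a(r)$. An *execution* of $A$ under the *fully synchronous scheduler* is a sequence $(C_i)_{i\ge0}$ in $\mathcal C(G,k)$ such that for every $i$ and every $a\in C_i$ there is $a'\in C_{i+1}$ such that, for every robot $r$, $a'(r)$ is equal or adjacent to $a(r)$ and $a'(r)\in A(C_i,U)_a$, where $U$ is the class with $a(r)\in U_a$. For $f:\mathbb N_n\to\mathbb N_n$, let $\Gamma_f$ be the network on $\mathbb N_n$ with edges $\{x,f(x)\}$ and labels $\ell(u,v)=v$, and let $A_f$ be the algorithm for one robot on $\Gamma_f$ that always moves the robot from $x$ to $f(x)$. An algorithm $A$ for $k$ robots on $G$ *computes* $f$ if there is a surjective partial function $\varphi:\mathcal C(G,k)\to\mathcal C(\Gamma_f,1)$ such that for every fully synchronous execution $(C_i)$ of $A$ there is a fully synchronous execution $(C'_i)$ of $A_f$ for which either $\varphi(C_0)$ is undefined, or there is a weakly increasing surjection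 $\sigma:\mathbb N\to\mathbb N$ such that, for all $i$, $\varphi(C_i)$ is defined and equal to $C'_{\sigma(i)}$. The *oriented path* with $m$ vertices is the path $0,1,\dots,m-1$ in which every edge is labeled $1$ towards the right neighbor and $0$ towards the left neighbor. **Lemma.** For every $n\ge1$ and every function $f:\mathbb N_n\to\mathbb N_n$, there is a sequential algorithm for two robots on the oriented path with $2n$ vertices that computes $f$ under the fully synchronous scheduler. -/

import Mathlib

namespace Robots

universe u v

/-- A labeled graph (network): an undirected base graph, in which loops are allowed, and a natural
number on every ordered pair of adjacent vertices. The value of `label` on a pair of vertices that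
are not adjacent is never used. -/
structure Network (V : Type u) where
  Adj : V → V → Prop
  symm : ∀ u v, Adj u v → Adj v u
  label : V → V → ℕ

/-- An automorphism of a network: a permutation of the vertices that preserves adjacencies and
labels. -/
structure Network.IsAut {V : Type u} (G : Network V) (α : Equiv.Perm V) : Prop where
  adj_iff : ∀ u v, G.Adj (α u) (α v) ↔ G.Adj u v
  label_eq : ∀ u v, G.Adj u v → G.label (α u) (α v) = G.label u v

theorem Network.IsAut.one {V : Type u} (G : Network V) : G.IsAut 1 :=
  ⟨fun _ _ => Iff.rfl, fun _ _ _ => rfl⟩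

theorem Network.IsAut.inv {V : Type u} {G : Network V} {α : Equiv.Perm V} (h : G.IsAut α) :
    G.IsAut α⁻¹ where
  adj_iff u v := by simpa using (h.adj_iff (α⁻¹ u) (α⁻¹ v)).symm
  label_eq u v huv := by
    have h1 : G.Adj (α⁻¹ u) (α⁻¹ v) := by
      rw [← h.adj_iff]; simpa using huv
    simpa using (h.label_eq _ _ h1).symm

theorem Network.IsAut.mul {V : Type u} {G : Network V} {α β : Equiv.Perm V}
    (hα : G.IsAut α) (hβ : G.IsAut β) : G.IsAut (α * β) where
  adj_iff u v := (hα.adj_iff _ _).trans (hβ.adj_iff u v)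
  label_eq u v huv :=
    (hα.label_eq _ _ ((hβ.adj_iff u v).2 huv)).trans (hβ.label_eq u v huv)

/-- An arrangement of `k` (distinguishable) robots on vertices of `V`. -/
abbrev Arrangement (V : Type u) (k : ℕ) := Fin k → V

/-- The arrangements `a₁`, `a₂` are equivalent under the automorphism `α` and the permutation `π`
of the robots. -/
def EquivUnder {V : Type u} (G : Network V) {k : ℕ} (a₁ a₂ : Arrangement V k)
    (α : Equiv.Perm V) (π : Equiv.Perm (Fin k)) : Prop :=
  G.IsAut α ∧ α ∘ a₁ = a₂ ∘ π

/-- Equivalence of arrangements. -/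
def arrangementSetoid {V : Type u} (G : Network V) (k : ℕ) : Setoid (Arrangement V k) where
  r a₁ a₂ := ∃ α π, EquivUnder G a₁ a₂ α π
  iseqv :=
    { refl := fun _ => ⟨1, 1, Network.IsAut.one G, rfl⟩
      symm := by
        rintro a₁ a₂ ⟨α, π, hα, h⟩
        refine ⟨α⁻¹, π⁻¹, hα.inv, funext fun r => ?_⟩
        obtain ⟨s, rfl⟩ := π.surjective r
        have := congrFun h s
        simp only [Function.comp_apply] at this
        simp [← this]
      trans := by
        rintro a₁ a₂ a₃ ⟨α, π, hα, h⟩ ⟨β, ρ, hβ, h'⟩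
        refine ⟨β * α, ρ * π, hβ.mul hα, funext fun r => ?_⟩
        have h1 := congrFun h r
        have h2 := congrFun h' (π r)
        simp only [Function.comp_apply] at h1 h2
        simp [h1, h2] }

/-- The configuration space: arrangements up to equivalence. -/
abbrev Config {V : Type u} (G : Network V) (k : ℕ) := Quotient (arrangementSetoid G k)

/-- The type of arrangements that belong to the configuration `C`. -/
abbrev Member {V : Type u} {G : Network V} {k : ℕ} (C : Config G k) :=
  {a : Arrangement V k // Quotient.mk (arrangementSetoid G k) a = C}

/-- Equivalence of vertices in an arrangement. -/
def EquivVertices {V : Type u} (G : Network V) {k : ℕ} (a : Arrangement V k) (v w : V) : Prop :=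
  ∃ α π, EquivUnder G a a α π ∧ α v = w

/-- A class of indistinguishable vertices of a configuration `C`: it maps every arrangement `a` in
`C` to an equivalence class of vertices of `a`, compatibly with all the equivalences between
arrangements in `C`. -/
@[ext]
structure VertexClass {V : Type u} {G : Network V} {k : ℕ} (C : Config G k) where
  at' : Member C → Set V
  isClass : ∀ a, ∃ v, at' a = {w | EquivVertices G a.1 v w}
  equivariant : ∀ (a₁ a₂ : Member C) (α : Equiv.Perm V) (π : Equiv.Perm (Fin k)),
    EquivUnder G a₁.1 a₂.1 α π → α '' at' a₁ = at' a₂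

/-- An algorithm for `k` robots on the network `G`: from the configuration and the class of the
location of a robot it computes the class of the destination, which has to be reachable in at most
one hop. -/
structure Algorithm {V : Type u} (G : Network V) (k : ℕ) where
  dest : (C : Config G k) → VertexClass C → VertexClass C
  reachable : ∀ (C : Config G k) (U : VertexClass C) (a : Member C), ∀ u ∈ U.at' a,
    ∃ u' ∈ (dest C U).at' a, u = u' ∨ G.Adj u u'

/-- An execution: a sequence of configurations. -/
abbrev Execution {V : Type u} (G : Network V) (k : ℕ) := ℕ → Config G k

/-- A scheduler: a binary relation between algorithms and executions. -/
abbrev Scheduler {V : Type u} (G : Network V) (k : ℕ) := Algorithm G k → Execution G k → Prop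

/-- A system of oblivious mobile robots. -/
structure RobotSystem (V : Type u) where
  G : Network V
  k : ℕ
  k_pos : 1 ≤ k
  S : Scheduler G k

/-- The configuration `C'` yields from the configuration `C` under the algorithm `A`. -/
def Yields {V : Type u} {G : Network V} {k : ℕ} (A : Algorithm G k) (C C' : Config G k) : Prop :=
  ∀ a : Member C, ∃ a' : Member C', ∀ r : Fin k,
    (a.1 r = a'.1 r ∨ G.Adj (a.1 r) (a'.1 r)) ∧
      ∀ U : VertexClass C, a.1 r ∈ U.at' a → a'.1 r ∈ (A.dest C U).at' a

/-- The fully synchronous scheduler. -/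
def fullySync {V : Type u} (G : Network V) (k : ℕ) : Scheduler G k :=
  fun A E => ∀ i, Yields A (E i) (E (i + 1))

/-- The system of `k` robots on `G` under the fully synchronous scheduler. -/
def FS {V : Type u} (G : Network V) (k : ℕ) (hk : 1 ≤ k) : RobotSystem V :=
  ⟨G, k, hk, fullySync G k⟩

/-- The execution `E` is compliant with the execution `E'` under the partial function `φ`. -/
def Compliant {V : Type u} {V' : Type v} {G : Network V} {G' : Network V'} {k k' : ℕ}
    (φ : Config G k →. Config G' k') (E : Execution G k) (E' : Execution G' k') : Prop :=
  ¬ (φ (E 0)).Dom ∨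
    ∃ σ : ℕ → ℕ, Monotone σ ∧ Function.Surjective σ ∧ ∀ i, E' (σ i) ∈ φ (E i)

/-- The algorithm `A` under the system `Ψ` simulates the algorithm `A'` under the system `Ψ'`. -/
def Simulates {V : Type u} {V' : Type v} (Ψ : RobotSystem V) (A : Algorithm Ψ.G Ψ.k)
    (Ψ' : RobotSystem V') (A' : Algorithm Ψ'.G Ψ'.k) : Prop :=
  ∃ φ : Config Ψ.G Ψ.k →. Config Ψ'.G Ψ'.k,
    (∀ C', ∃ C, C' ∈ φ C) ∧
      ∀ E, Ψ.S A E → ∃ E', Ψ'.S A' E' ∧ Compliant φ E E'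

/-- The network induced by a function `f`: its edges are the pairs `{x, f x}` (a loop if `x` is a
fixed point), and the ordered pair `(u, v)` is labeled `v`. -/
def inducedNetwork {n : ℕ} (f : Fin n → Fin n) : Network (Fin n) where
  Adj u v := f u = v ∨ f v = u
  symm _ _ := Or.symm
  label _ v := v

theorem inducedNetwork_aut {n : ℕ} (f : Fin n → Fin n) {α : Equiv.Perm (Fin n)}
    (h : (inducedNetwork f).IsAut α) : α = 1 := by
  ext x
  exact h.label_eq (f x) x (Or.inr rfl)

theorem equivVertices_inducedNetwork {n : ℕ} (f : Fin n → Fin n) {k : ℕ}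
    (a : Arrangement (Fin n) k) (v w : Fin n) :
    EquivVertices (inducedNetwork f) a v w ↔ v = w := by
  constructor
  · rintro ⟨α, π, ⟨hα, -⟩, rfl⟩
    rw [inducedNetwork_aut f hα]; rfl
  · rintro rfl
    exact ⟨1, 1, ⟨Network.IsAut.one _, rfl⟩, rfl⟩

/-- The algorithm associated to `f`: the robot always moves from `x` to `f x`. -/
def functionAlgorithm {n : ℕ} (f : Fin n → Fin n) : Algorithm (inducedNetwork f) 1 where
  dest C U :=
    { at' := fun a => f '' U.at' a
      isClass := fun a => by
        obtain ⟨v, hv⟩ := U.isClass a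
        refine ⟨f v, ?_⟩
        rw [hv]
        ext w
        simp [equivVertices_inducedNetwork]
      equivariant := fun a₁ a₂ α π h => by
        have h1 := U.equivariant a₁ a₂ α π h
        rw [inducedNetwork_aut f h.1] at h1 ⊢
        simp only [Equiv.Perm.coe_one, Set.image_id] at h1 ⊢
        rw [h1] }
  reachable _ _ _ u hu := ⟨f u, ⟨u, hu, rfl⟩, Or.inr (Or.inl rfl)⟩

/-- The algorithm `A` computes the function `f` under the system `Ψ`. -/
def Computes {V : Type u} (Ψ : RobotSystem V) (A : Algorithm Ψ.G Ψ.k) {n : ℕ}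
    (f : Fin n → Fin n) : Prop :=
  Simulates Ψ A (FS (inducedNetwork f) 1 le_rfl) (functionAlgorithm f)

/-- In the arrangement `a`, the algorithm `A` instructs the robot `r` to move: its destination
class contains a vertex adjacent to and different from its location. -/
def Algorithm.InstructsToMove {V : Type u} {G : Network V} {k : ℕ} (A : Algorithm G k)
    {C : Config G k} (a : Member C) (r : Fin k) : Prop :=
  ∃ U : VertexClass C, a.1 r ∈ U.at' a ∧
    ∃ w ∈ (A.dest C U).at' a, w ≠ a.1 r ∧ G.Adj (a.1 r) w

/-- An algorithm is sequential if it never instructs two robots to move at the same time. -/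
def Algorithm.IsSequential {V : Type u} {G : Network V} {k : ℕ} (A : Algorithm G k) : Prop :=
  ∀ (C : Config G k) (a : Member C) (r s : Fin k),
    A.InstructsToMove a r → A.InstructsToMove a s → r = s

/-- The oriented path with `m` vertices: at every vertex, the label of the edge to the right
neighbor is `1` and the label of the edge to the left neighbor is `0`. -/
def orientedPath (m : ℕ) : Network (Fin m) where
  Adj := (SimpleGraph.pathGraph m).Adj
  symm _ _ h := h.symm
  label u v := if u < v then 1 else 0

/-- The system of `k` robots on the oriented path with `m` vertices, fully synchronous. -/
def OP (m k : ℕ) (hk : 1 ≤ k) : RobotSystem (Fin m) :=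
  FS (orientedPath m) k hk

end Robots

/-! One robot in each half of the path encodes a point `(c, r)` of an `n × n` grid, and moving one
robot moves the point horizontally or vertically. To apply `g` to `x`, the point travels from `(x,
x)` along column `x` to `(x, g x)`, then along row `g x` to `(g x, g x)`. The robots have no memory,
so a point must determine both the element it stands for and the next move. Horizontal parts that
overlap lie in one row `r` and all stand for `r`. The only ambiguity is a vertical part meeting the
horizontal part of another route before its own corner.

Routes of arcs `x → g x` that point right lie on or above the diagonal, those of arcs that point
left on or below it. An ambiguous meeting occurs only when two arcs of the same direction cross
(`not_onRow_of_onColumn`). It therefore suffices to renumber the domain so that such crossings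
disappear, which is possible for every `f` (`exists_noncrossingOn`). The rest checks that every
route is completed (`exists_advances`) and that the orientation of the path makes robot positions
readable (`orientedPath_aut`, `gridConfig_injective`). -/

open Function

namespace Robots

/-! ### Orderings without crossing arcs -/

/-- The arcs from `x` to `f x` for `x` in `s`, drawn on a line according to `p`, have no crossing
between two arcs that point to the right, and none between two arcs that point to the left. -/
def NoncrossingOn {V : Type*} {L : Type*} [LT L] (s : Finset V) (f : V → V) (p : V → L) : Prop :=
  ∀ x ∈ s, ∀ w ∈ s, ¬ (p x < p w ∧ p w < p (f x) ∧ p (f x) < p (f w)) ∧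
    ¬ (p (f x) < p (f w) ∧ p (f w) < p x ∧ p x < p w)

/-- A moved element is not in the image of `f`, or `f` is injective. -/
theorem exists_moved_of_exists_preimage_imp_injOn {V : Type*} [DecidableEq V] (s : Finset V) (f : V → V)
    (hf : ∀ x ∈ s, f x ∈ s) (hne : ∃ x ∈ s, f x ≠ x) :
    ∃ y ∈ s, f y ≠ y ∧ ∀ x ∈ s, f x = y → ∀ w ∈ s, ∀ w' ∈ s, f w = f w' → w = w' := by
  by_cases hinj : Set.InjOn f s
  · obtain ⟨y, hy, h⟩ := hne
    exact ⟨y, hy, h, fun _ _ _ _ hw _ hw' e => hinj hw hw' e⟩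
  · have hsurj : ¬ Set.SurjOn f s s := fun h =>
      hinj (Finset.injOn_of_surjOn_of_card_le f hf h le_rfl)
    obtain ⟨y, hy, h⟩ := Set.not_subset.1 hsurj
    refine ⟨y, hy, fun e => h ⟨y, hy, e⟩, fun x hx e => (h ⟨x, hx, e⟩).elim⟩

/-- Induction by contraction: a moved point `y` is deleted and its preimages are sent directly to `f
y`. Afterwards `y` is put back immediately beside `f y`, so that no point lies inside the arc `y → f
y`. If `y` has a preimage `x`, it is put on the side of `f y` facing `x`, so `x → y` is almost the
old arc `x → f y`. -/
theorem exists_noncrossingOn {V : Type*} [Countable V] (s : Finset V) (f : V → V)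
    (hf : ∀ x ∈ s, f x ∈ s) : ∃ p : V → ℤ, Set.InjOn p s ∧ NoncrossingOn s f p := by
  classical
  induction hk : s.card generalizing s f with
  | zero =>
    obtain rfl := Finset.card_eq_zero.1 hk
    exact ⟨fun _ => 0, by simp, by simp [NoncrossingOn]⟩
  | succ k ih =>
    by_cases hne : ∃ x ∈ s, f x ≠ x
    · obtain ⟨y, hy, hfy, hpre⟩ := exists_moved_of_exists_preimage_imp_injOn s f hf hne
      obtain ⟨p, hp, hnc⟩ := ih (s.erase y) (fun x => if f x = y then f y else f x)
        (fun x hx => by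
          have := Finset.mem_of_mem_erase hx
          split_ifs with h
          · exact Finset.mem_erase.2 ⟨hfy, hf y hy⟩
          · exact Finset.mem_erase.2 ⟨h, hf x this⟩)
        (by rw [Finset.card_erase_of_mem hy, hk]; rfl)
      -- `ε` is the side of `f y` on which `y` is inserted. It is forced only by a preimage of `y`,
      -- and there is at most one by `hpre`.
      obtain ⟨ε, hε, hside⟩ : ∃ ε : ℤ, (ε = 1 ∨ ε = -1) ∧ ∀ x ∈ s, f x = y →
          (p x < p (f y) → ε = -1) ∧ (p (f y) < p x → ε = 1) := by
        by_cases h : ∃ x ∈ s, f x = y ∧ p x < p (f y)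
        · obtain ⟨x, hx, hxy, hlt⟩ := h
          refine ⟨-1, Or.inr rfl, fun x' hx' hxy' => ?_⟩
          rw [hpre x hx hxy x' hx' x hx (hxy'.trans hxy.symm)]
          exact ⟨fun _ => rfl, fun h => absurd h hlt.asymm⟩
        · push Not at h
          exact ⟨1, Or.inl rfl, fun x hx hxy => ⟨fun h' => absurd h' (h x hx hxy).not_gt,
            fun _ => rfl⟩⟩
      have key : ∀ a ∈ s, a ≠ y → ∀ b ∈ s, b ≠ y → p a = p b → a = b := fun a ha ha' b hb hb' h =>
        hp (by simp [ha, ha']) (by simp [hb, hb']) h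
      -- Tripling the positions leaves a free integer on either side of `f y`.
      refine ⟨fun x => if x = y then 3 * p (f y) + ε else 3 * p x, ?_, ?_⟩
      · intro a ha b hb hab
        simp only [] at hab
        split_ifs at hab with h1 h2 h2
        · rw [h1, h2]
        · omega
        · omega
        · exact key a ha h1 b hb h2 (by omega)
      · intro x hx w hw
        have hx' := hside x hx
        have hw' := hside w hw
        have k5 := fun h : f x = y => hpre x hx h w hw y hy
        have k6 := fun h : f w = y => hpre w hw h x hx y hy
        have k1 : x ≠ y → p x = p (f y) → x = f y := fun h => key x hx h _ (hf y hy) hfy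
        have k2 : w ≠ y → p w = p (f y) → w = f y := fun h => key w hw h _ (hf y hy) hfy
        have k3 : f x ≠ y → p (f x) = p (f y) → f x = f y :=
          fun h => key _ (hf x hx) h _ (hf y hy) hfy
        have k4 : f w ≠ y → p (f w) = p (f y) → f w = f y :=
          fun h => key _ (hf w hw) h _ (hf y hy) hfy
        have hxw : x ≠ y → w ≠ y → _ := fun h1 h2 => hnc x (by simp [hx, h1]) w (by simp [hw, h2])
        by_cases h1 : x = y <;> by_cases h2 : w = y
        · subst h1 h2; simp
        · subst h1
          by_cases h3 : f w = x <;>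
            simp only [h2, h3, hfy, if_true, if_false] at * <;> omega
        · subst h2
          by_cases h3 : f x = w <;>
            simp only [h1, h3, hfy, if_true, if_false] at * <;> omega
        · have hxw := hxw h1 h2
          by_cases h3 : f x = y <;> by_cases h4 : f w = y
          · rw [hpre x hx h3 x hx w hw (h3.trans h4.symm)]; simp
          · have k5 : p (f w) ≠ p (f y) := fun e => h2 (k5 h3 (k4 h4 e))
            have hx' := hx' h3
            simp only [h1, h2, h3, h4, if_true, if_false] at *
            omega
          · have k6 : p (f x) ≠ p (f y) := fun e => h1 (k6 h4 (k3 h3 e))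
            have hw' := hw' h4
            simp only [h1, h2, h3, h4, if_true, if_false] at *
            omega
          · simp only [h1, h2, h3, h4, if_false] at *
            omega
    · push Not at hne
      obtain ⟨e, he⟩ := exists_injective_nat V
      refine ⟨fun x => e x, fun a _ b _ h => he (by simpa using h), fun x hx w hw => ?_⟩
      rw [hne x hx, hne w hw]
      omega

theorem exists_equiv_noncrossing {n : ℕ} (f : Fin n → Fin n) :
    ∃ q : Fin n ≃ Fin n, NoncrossingOn Finset.univ (q ∘ f ∘ q.symm) id := by
  obtain ⟨p, hp, hnc⟩ := exists_noncrossingOn Finset.univ f (by simp)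
  have hp : Injective p := by simpa using hp
  have hcard : (Finset.univ.image p).card = n := by
    rw [Finset.card_image_of_injective _ hp]; simp
  let o := (Finset.univ.image p).orderIsoOfFin hcard
  let e : Fin n → Fin n := fun x => o.symm ⟨p x, by simp⟩
  have he : ∀ x y, e x < e y ↔ p x < p y := fun x y => by simp [e]
  have hinj : Injective e := fun x y h => by simpa [e, hp.eq_iff] using h
  let q := Equiv.ofBijective e (Finite.injective_iff_bijective.1 hinj)
  refine ⟨q, fun x _ w _ => ?_⟩
  obtain ⟨x, rfl⟩ := q.surjective x
  obtain ⟨w, rfl⟩ := q.surjective w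
  have := hnc x (by simp) w (by simp)
  simp only [comp_apply, Equiv.symm_apply_apply, id]
  simpa only [q, Equiv.ofBijective_apply, he] using this

/-! ### Routing on the grid -/

/-- The neighbor of `a` in the direction of `b`. -/
def stepToward {n : ℕ} (a b : Fin n) : Fin n :=
  if a < b then ⟨min (a + 1) b, by omega⟩ else ⟨max (a - 1) b, by omega⟩

theorem val_stepToward {n : ℕ} (a b : Fin n) :
    (stepToward a b : ℕ) = if (a : ℕ) < b then (a : ℕ) + 1 else if (b : ℕ) < a then a - 1 else a := by
  unfold stepToward
  simp only [Fin.lt_def]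
  split_ifs <;> simp only [] <;> omega

variable {n : ℕ} (g : Fin n → Fin n)

/-- The point of the grid in column `c` and row `r` lies on the horizontal part of the route of some
`w` to `g w`. -/
def OnRow (c r : Fin n) : Prop :=
  ∃ w, g w = r ∧ ((r < c ∧ c ≤ w) ∨ (w ≤ c ∧ c < r))

/-- The point of the grid in column `c` and row `r` lies on the vertical part of the route of `c` to
`g c`. -/
def OnColumn (c r : Fin n) : Prop :=
  (c ≤ r ∧ r ≤ g c) ∨ (g c ≤ r ∧ r ≤ c)

open Classical in
/-- The column after one step from the point `(c, r)`. -/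
noncomputable def nextColumn (c r : Fin n) : Fin n :=
  if OnRow g c r then stepToward c r else c

open Classical in
/-- The row after one step from the point `(c, r)`. -/
noncomputable def nextRow (c r : Fin n) : Fin n :=
  if OnRow g c r then r else stepToward r (g c)

open Classical in
/-- The element of the domain of `g` that the point `(c, r)` represents. -/
noncomputable def represented (c r : Fin n) : Fin n :=
  if OnRow g c r then r else c

/-- The point `(c, r)` represents an element of the domain of `g`. -/
def OnRoute (c r : Fin n) : Prop := OnRow g c r ∨ OnColumn g c r

/-- The step from `(c, r)` completes the vertical part of a route. -/
def Advances (c r : Fin n) : Prop := ¬ OnRow g c r ∧ nextRow g c r = g c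

/-- The horizontal part of a route omits its end on the diagonal, so a point there starts the next
vertical part. By `onRow_apply` the corner does belong to the horizontal part; hence the represented
element changes exactly on reaching the corner. -/
theorem not_onRow_self (c : Fin n) : ¬ OnRow g c c := by
  rintro ⟨w, -, h | h⟩
  · exact absurd h.1 (lt_irrefl _)
  · exact absurd h.2 (lt_irrefl _)

theorem onRow_apply {c : Fin n} (h : c ≠ g c) : OnRow g c (g c) := by
  refine ⟨c, rfl, ?_⟩
  rcases lt_or_gt_of_ne h with h | h
  · exact Or.inr ⟨le_rfl, h⟩
  · exact Or.inl ⟨h, le_rfl⟩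

variable {g}

/-- If the route of `w` passes horizontally through `(c, g w)`, then `w < c < g w < g c` when column
`c` is travelled upwards, and `g c < g w < c < w` when downwards. Both are forbidden crossings. -/
theorem not_onRow_of_onColumn (hg : NoncrossingOn Finset.univ g id) {c r : Fin n}
    (h : OnColumn g c r) (hr : r ≠ g c) : ¬ OnRow g c r := by
  rintro ⟨w, rfl, hw⟩
  have hcw : c ≠ w := by rintro rfl; exact hr rfl
  have h1 := hg c (by simp) w (by simp)
  have h2 := hg w (by simp) c (by simp)
  simp only [OnColumn, id] at h h1 h2
  omega

theorem routing_step (hg : NoncrossingOn Finset.univ g id) {c r : Fin n} (h : OnRoute g c r) :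
    OnRoute g (nextColumn g c r) (nextRow g c r) ∧
    (Advances g c r →
      represented g (nextColumn g c r) (nextRow g c r) = g (represented g c r)) ∧
    (¬ Advances g c r →
      represented g (nextColumn g c r) (nextRow g c r) = represented g c r) := by
  by_cases hH : OnRow g c r
  · have hc : nextColumn g c r = stepToward c r := by simp [nextColumn, hH]
    have hr : nextRow g c r = r := by simp [nextRow, hH]
    have hv : represented g c r = r := by simp [represented, hH]
    have ha : ¬ Advances g c r := by simp [Advances, hH]
    rw [hc, hr, hv]
    simp only [ha, false_implies, true_and, not_false_eq_true, true_implies]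
    obtain ⟨w, hw, hcw⟩ := hH
    have hs := val_stepToward c r
    by_cases he : stepToward c r = r
    · rw [he]
      refine ⟨Or.inr ?_, by simp [represented]⟩
      simp only [OnColumn]; omega
    · have : OnRow g (stepToward c r) r := ⟨w, hw, by
        split_ifs at hs <;> omega⟩
      exact ⟨Or.inl this, by simp [represented, this]⟩
  · have hc : nextColumn g c r = c := by simp [nextColumn, hH]
    have hr : nextRow g c r = stepToward r (g c) := by simp [nextRow, hH]
    have hv : represented g c r = c := by simp [represented, hH]
    have hC : OnColumn g c r := h.resolve_left hH
    have hs := val_stepToward r (g c)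
    simp only [Advances, hH, hc, hr, hv, not_false_eq_true, true_and]
    by_cases he : stepToward r (g c) = g c
    · simp only [he, true_implies, not_true, false_implies, and_true]
      -- At a fixed point the robots stand still, yet every step counts as an advance.
      by_cases hcg : c = g c
      · rw [← hcg]
        refine ⟨Or.inr ?_, by simp [represented]⟩
        simp only [OnColumn]; omega
      · have := onRow_apply g hcg
        exact ⟨Or.inl this, by simp [represented, this]⟩
    · simp only [he, not_false_eq_true, true_implies, false_implies, true_and]
      have hC' : OnColumn g c (stepToward r (g c)) := by
        simp only [OnColumn] at hC ⊢
        split_ifs at hs <;> omega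
      exact ⟨Or.inr hC', by simp [represented, not_onRow_of_onColumn hg hC' he]⟩

/-- On a vertical part the distance to the corner decreases, on a horizontal part the distance to
the diagonal; after the diagonal a vertical part follows. -/
theorem exists_advances (hg : NoncrossingOn Finset.univ g id) (P : ℕ → Fin n × Fin n)
    (hP : ∀ i, P (i + 1) = (nextColumn g (P i).1 (P i).2, nextRow g (P i).1 (P i).2))
    (hv : ∀ i, OnRoute g (P i).1 (P i).2) (i : ℕ) :
    ∃ j ≥ i, Advances g (P j).1 (P j).2 := by
  have column : ∀ k i, ¬ OnRow g (P i).1 (P i).2 → Nat.dist (P i).2 (g (P i).1) ≤ k →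
      ∃ j ≥ i, Advances g (P j).1 (P j).2 := by
    intro k
    induction k with
    | zero =>
      intro i h hk
      refine ⟨i, le_rfl, h, ?_⟩
      have hs := val_stepToward (P i).2 (g (P i).1)
      simp only [nextRow, h, if_false]
      simp only [Nat.dist] at hk
      split_ifs at hs <;> omega
    | succ k ih =>
      intro i h hk
      by_cases ha : Advances g (P i).1 (P i).2
      · exact ⟨i, le_rfl, ha⟩
      have hr : nextRow g (P i).1 (P i).2 = stepToward (P i).2 (g (P i).1) := by
        simp [nextRow, h]
      have hc : nextColumn g (P i).1 (P i).2 = (P i).1 := by simp [nextColumn, h]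
      have hs := val_stepToward (P i).2 (g (P i).1)
      have hne : stepToward (P i).2 (g (P i).1) ≠ g (P i).1 := fun e => ha ⟨h, hr.trans e⟩
      have hC := (hv i).resolve_left h
      have hC' : OnColumn g (P i).1 (stepToward (P i).2 (g (P i).1)) := by
        simp only [OnColumn] at hC ⊢
        split_ifs at hs <;> omega
      obtain ⟨j, hj, hadv⟩ := ih (i + 1)
        (by rw [hP, hr, hc]; exact not_onRow_of_onColumn hg hC' hne)
        (by
          rw [hP, hr, hc]
          simp only [Nat.dist] at hk ⊢
          split_ifs at hs <;> omega)
      exact ⟨j, by omega, hadv⟩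
  have row : ∀ k i, OnRow g (P i).1 (P i).2 → Nat.dist (P i).1 (P i).2 ≤ k →
      ∃ j ≥ i, Advances g (P j).1 (P j).2 := by
    intro k
    induction k with
    | zero =>
      intro i h hk
      have : (P i).1 = (P i).2 := Fin.ext (Nat.eq_of_dist_eq_zero (by omega))
      rw [this] at h
      exact (not_onRow_self g _ h).elim
    | succ k ih =>
      intro i h hk
      have hstep : ∃ j ≥ i + 1, Advances g (P j).1 (P j).2 := by
        by_cases h' : OnRow g (P (i + 1)).1 (P (i + 1)).2
        · apply ih _ h'
          rw [hP]
          simp only [nextColumn, nextRow, h, if_true]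
          have hs := val_stepToward (P i).1 (P i).2
          obtain ⟨w, -, hw⟩ := h
          simp only [Nat.dist] at hk ⊢
          split_ifs at hs <;> omega
        · exact column _ _ h' le_rfl
      obtain ⟨j, hj, hadv⟩ := hstep
      exact ⟨j, by omega, hadv⟩
  by_cases h : OnRow g (P i).1 (P i).2
  · exact row _ _ h le_rfl
  · exact column _ _ h le_rfl

/-- Following the routes simulates the iteration of `g`. -/
theorem routing_simulates (hg : NoncrossingOn Finset.univ g id) (P : ℕ → Fin n × Fin n)
    (hP : ∀ i, P (i + 1) = (nextColumn g (P i).1 (P i).2, nextRow g (P i).1 (P i).2))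
    (h0 : OnRoute g (P 0).1 (P 0).2) :
    ∃ σ : ℕ → ℕ, Monotone σ ∧ Surjective σ ∧ ∀ i, OnRoute g (P i).1 (P i).2 ∧
      represented g (P i).1 (P i).2 = g^[σ i] (represented g (P 0).1 (P 0).2) := by
  classical
  have hv : ∀ i, OnRoute g (P i).1 (P i).2 := fun i => by
    induction i with
    | zero => exact h0
    | succ i ih => rw [hP]; exact (routing_step hg ih).1
  let adv : ℕ → Prop := fun i => Advances g (P i).1 (P i).2
  have hinf : {i | adv i}.Infinite := Set.infinite_of_not_bddAbove fun ⟨b, hb⟩ => by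
    obtain ⟨j, hj, ha⟩ := exists_advances hg P hP hv (b + 1)
    have : j ≤ b := hb ha
    omega
  -- `σ i` counts the advances before time `i`; it is surjective because there are infinitely many.
  refine ⟨Nat.count adv, Nat.count_monotone adv,
    fun k => ⟨Nat.nth adv k, Nat.count_nth_of_infinite hinf k⟩, fun i => ⟨hv i, ?_⟩⟩
  induction i with
  | zero => simp
  | succ i ih =>
    obtain ⟨-, h1, h2⟩ := routing_step hg (hv i)
    rw [hP, Nat.count_succ]
    by_cases ha : adv i
    · rw [if_pos ha, iterate_succ_apply', ← ih]
      exact h1 ha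
    · rw [if_neg ha, add_zero, ← ih]
      exact h2 ha

theorem nextColumn_eq_or_nextRow_eq (c r : Fin n) : nextColumn g c r = c ∨ nextRow g c r = r := by
  by_cases h : OnRow g c r <;> simp [nextColumn, nextRow, h]

/-! ### Robots on an oriented path -/

/-- Preserving the label `1` of the edges to the right makes `α` strictly increasing, and a finite
chain has only one order automorphism. -/
theorem orientedPath_aut {m : ℕ} {α : Equiv.Perm (Fin m)} (h : (orientedPath m).IsAut α) :
    α = 1 := by
  have hmono : StrictMono α := by
    cases m with
    | zero => exact fun a => a.elim0
    | succ m =>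
      refine Fin.strictMono_iff_lt_succ.2 fun i => ?_
      have hadj : (orientedPath (m + 1)).Adj i.castSucc i.succ := by
        simp [orientedPath, SimpleGraph.pathGraph_adj]
      have := h.label_eq _ _ hadj
      by_contra hlt
      simp [orientedPath, hlt] at this
  have : hmono.orderIsoOfSurjective α α.surjective = OrderIso.refl _ := Subsingleton.elim _ _
  ext x
  exact congrArg Fin.val (DFunLike.congr_fun this x)

variable {m k : ℕ}

theorem VertexClass.exists_eq_singleton {C : Config (orientedPath m) k} (U : VertexClass C) :
    ∃ v, ∀ a, U.at' a = {v} := by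
  obtain ⟨a₀, ha₀⟩ := Quotient.exists_rep C
  have single : ∀ a, ∃ v, U.at' a = {v} := fun a => by
    obtain ⟨v, hv⟩ := U.isClass a
    refine ⟨v, hv.trans (Set.ext fun w => ⟨?_, ?_⟩)⟩
    · rintro ⟨α, π, ⟨hα, -⟩, rfl⟩
      rw [orientedPath_aut hα]; rfl
    · rintro rfl
      exact ⟨1, 1, ⟨Network.IsAut.one _, rfl⟩, rfl⟩
  obtain ⟨v, hv⟩ := single ⟨a₀, ha₀⟩
  refine ⟨v, fun a => ?_⟩
  obtain ⟨α, π, h⟩ := Quotient.exact (ha₀.trans a.2.symm)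
  have := U.equivariant ⟨a₀, ha₀⟩ a α π h
  rw [← this, hv, orientedPath_aut h.1]
  simp

/-- On an oriented path, every vertex forms a class of indistinguishable vertices. -/
def singletonClass (C : Config (orientedPath m) k) (v : Fin m) : VertexClass C where
  at' _ := {v}
  isClass a := by
    refine ⟨v, Set.ext fun w => ⟨?_, ?_⟩⟩
    · rintro rfl
      exact ⟨1, 1, ⟨Network.IsAut.one _, rfl⟩, rfl⟩
    · rintro ⟨α, π, ⟨hα, -⟩, rfl⟩
      rw [orientedPath_aut hα]; rfl
  equivariant a₁ a₂ α π h := by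
    rw [orientedPath_aut h.1]; simp

/-- The algorithm on an oriented path that moves a robot from `v` to `δ C v`. -/
def pathAlgorithm (δ : Config (orientedPath m) k → Fin m → Fin m)
    (hδ : ∀ C v, v = δ C v ∨ (orientedPath m).Adj v (δ C v)) : Algorithm (orientedPath m) k where
  dest C U :=
    { at' := fun a => δ C '' U.at' a
      isClass := fun a => by
        obtain ⟨v, hv⟩ := U.exists_eq_singleton
        rw [hv, Set.image_singleton]
        exact (singletonClass C (δ C v)).isClass a
      equivariant := fun a₁ a₂ α π h => by
        obtain ⟨v, hv⟩ := U.exists_eq_singleton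
        rw [hv, hv, Set.image_singleton]
        exact (singletonClass C (δ C v)).equivariant a₁ a₂ α π h }
  reachable C _ _ u hu := ⟨δ C u, ⟨u, hu, rfl⟩, hδ C u⟩

/-- Classes are single vertices, so the algorithm leaves no choice and executions are deterministic.
-/
theorem pathAlgorithm_yields {δ : Config (orientedPath m) k → Fin m → Fin m}
    {hδ : ∀ C v, v = δ C v ∨ (orientedPath m).Adj v (δ C v)} {a : Arrangement (Fin m) k}
    {C C' : Config (orientedPath m) k} (hC : Quotient.mk _ a = C)
    (h : Yields (pathAlgorithm δ hδ) C C') : C' = Quotient.mk _ (δ C ∘ a) := by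
  obtain ⟨a', ha'⟩ := h ⟨a, hC⟩
  rw [← a'.2]
  congr 1
  funext r
  obtain ⟨v, hv, hv'⟩ := (ha' r).2 (singletonClass C (a r)) rfl
  rw [← hv', show v = a r from hv]
  rfl

theorem pathAlgorithm_ne_of_instructsToMove {δ : Config (orientedPath m) k → Fin m → Fin m}
    {hδ : ∀ C v, v = δ C v ∨ (orientedPath m).Adj v (δ C v)} {C : Config (orientedPath m) k}
    {a : Member C} {r : Fin k} (h : (pathAlgorithm δ hδ).InstructsToMove a r) :
    δ C (a.1 r) ≠ a.1 r := by
  obtain ⟨U, hU, w, ⟨v, hv, rfl⟩, hne, -⟩ := h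
  obtain ⟨u, hu⟩ := U.exists_eq_singleton
  rw [hu] at hU hv
  rw [Set.mem_singleton_iff] at hU hv
  rw [hU] at hne ⊢
  rwa [hv] at hne

/-! ### Two robots as a point of the grid -/

/-- The vertex of the left robot that encodes a column of the grid. -/
def leftVertex (c : Fin n) : Fin (2 * n) := ⟨c, by omega⟩

/-- The vertex of the right robot that encodes a row of the grid. -/
def rightVertex (r : Fin n) : Fin (2 * n) := ⟨n + r, by omega⟩

/-- The configuration of two robots that encodes a point of the grid. -/
def gridConfig (P : Fin n × Fin n) : Config (orientedPath (2 * n)) 2 :=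
  Quotient.mk _ ![leftVertex P.1, rightVertex P.2]

theorem leftVertex_ne_rightVertex (c r : Fin n) : leftVertex c ≠ rightVertex r := by
  simp only [leftVertex, rightVertex, ne_eq, Fin.mk.injEq]; omega

theorem leftVertex_injective : Injective (leftVertex (n := n)) := fun a b h => by
  simpa [leftVertex, Fin.ext_iff] using h

theorem rightVertex_injective : Injective (rightVertex (n := n)) := fun a b h => by
  simpa [rightVertex, Fin.ext_iff] using h

theorem exists_perm_of_mk_eq {a b : Arrangement (Fin m) k}
    (h : Quotient.mk (arrangementSetoid (orientedPath m) k) a = Quotient.mk _ b) :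
    ∃ π : Equiv.Perm (Fin k), a = b ∘ π := by
  obtain ⟨α, π, hα, h⟩ := Quotient.exact h
  exact ⟨π, by simpa [orientedPath_aut hα] using h⟩

/-- Anonymity of the robots does no harm: the two halves of the path are disjoint, so the half tells
which robot is which. -/
theorem gridConfig_injective : Injective (gridConfig (n := n)) := by
  rintro ⟨c, r⟩ ⟨c', r'⟩ h
  obtain ⟨π, h⟩ := exists_perm_of_mk_eq h
  have h0 := congrFun h 0
  have h1 := congrFun h 1
  simp only [comp_apply] at h0 h1
  rcases Fin.exists_fin_two.1 ⟨π 0, rfl⟩ with e | e <;>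
    rcases Fin.exists_fin_two.1 ⟨π 1, rfl⟩ with e' | e' <;>
    simp [e, e', leftVertex_ne_rightVertex, (leftVertex_ne_rightVertex _ _).symm,
      leftVertex_injective.eq_iff, rightVertex_injective.eq_iff] at h0 h1
  exact Prod.ext h0 h1

variable (g)

open Classical in
/-- The move of a robot located at `v` in the configuration `C`, when the two robots follow the
routes of `g`. -/
noncomputable def routeMove (C : Config (orientedPath (2 * n)) 2) (v : Fin (2 * n)) :
    Fin (2 * n) :=
  if h : ∃ P, gridConfig P = C then
    if v = leftVertex h.choose.1 then leftVertex (nextColumn g h.choose.1 h.choose.2)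
    else if v = rightVertex h.choose.2 then rightVertex (nextRow g h.choose.1 h.choose.2)
    else v
  else v

theorem routeMove_gridConfig (P : Fin n × Fin n) (v : Fin (2 * n)) :
    routeMove g (gridConfig P) v =
      if v = leftVertex P.1 then leftVertex (nextColumn g P.1 P.2)
      else if v = rightVertex P.2 then rightVertex (nextRow g P.1 P.2) else v := by
  have h : ∃ Q, gridConfig Q = gridConfig P := ⟨P, rfl⟩
  have e : h.choose = P := gridConfig_injective h.choose_spec
  rw [routeMove, dif_pos h, e]

theorem stepToward_adjacent (a b : Fin n) :
    a = stepToward a b ∨ (a : ℕ) + 1 = stepToward a b ∨ (stepToward a b : ℕ) + 1 = a := by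
  have := val_stepToward a b
  split_ifs at this <;> omega

theorem routeMove_adjacent (C : Config (orientedPath (2 * n)) 2) (v : Fin (2 * n)) :
    v = routeMove g C v ∨ (orientedPath (2 * n)).Adj v (routeMove g C v) := by
  by_cases h : ∃ P, gridConfig P = C
  · obtain ⟨⟨c, r⟩, rfl⟩ := h
    rw [routeMove_gridConfig]
    simp only [orientedPath, SimpleGraph.pathGraph_adj]
    have hc := stepToward_adjacent c r
    have hr := stepToward_adjacent r (g c)
    split_ifs with h1 h2
    · subst h1
      simp only [leftVertex, nextColumn, Fin.ext_iff] at hc ⊢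
      split_ifs <;> omega
    · subst h2
      simp only [rightVertex, nextRow, Fin.ext_iff] at hr ⊢
      split_ifs <;> omega
    · exact Or.inl rfl
  · left; simp [routeMove, h]

/-- The two robots follow the routes of `g`. -/
noncomputable def routeAlgorithm : Algorithm (orientedPath (2 * n)) 2 :=
  pathAlgorithm (routeMove g) (routeMove_adjacent g)

theorem routeAlgorithm_isSequential : (routeAlgorithm g).IsSequential := by
  intro C a r s hr hs
  have hr := pathAlgorithm_ne_of_instructsToMove hr
  have hs := pathAlgorithm_ne_of_instructsToMove hs
  by_cases h : ∃ P, gridConfig P = C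
  · obtain ⟨⟨c, d⟩, h⟩ := h
    obtain ⟨π, ha⟩ := exists_perm_of_mk_eq (a.2.trans h.symm)
    have move := routeMove_gridConfig g (c, d)
    rw [h] at move
    rw [move, ha] at hr hs
    -- A representative of `C` may list the robots in either order; `π` translates to the order in
    -- which robot `0` is the left one.
    apply π.injective
    simp only [comp_apply] at hr hs
    generalize π r = r at hr
    generalize π s = s at hs
    have := nextColumn_eq_or_nextRow_eq (g := g) c d
    fin_cases r <;> fin_cases s <;>
      simp_all [(leftVertex_ne_rightVertex _ _).symm, leftVertex_injective.eq_iff,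
        rightVertex_injective.eq_iff]
  · simp [routeMove, h] at hr

theorem routeAlgorithm_yields {P : Fin n × Fin n} {C : Config (orientedPath (2 * n)) 2}
    (h : Yields (routeAlgorithm g) (gridConfig P) C) :
    C = gridConfig (nextColumn g P.1 P.2, nextRow g P.1 P.2) := by
  rw [pathAlgorithm_yields (C := gridConfig P) rfl h]
  refine congrArg (Quotient.mk _) (funext fun i => ?_)
  fin_cases i <;>
    simp [routeMove_gridConfig, (leftVertex_ne_rightVertex _ _).symm]

/-! ### The simulation -/

/-- The configuration of one robot on the network of `f`, located at `x`. -/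
def pointConfig (f : Fin n → Fin n) (x : Fin n) : Config (inducedNetwork f) 1 :=
  Quotient.mk _ fun _ => x

theorem functionAlgorithm_yields (f : Fin n → Fin n) (x : Fin n) :
    Yields (functionAlgorithm f) (pointConfig f x) (pointConfig f (f x)) := by
  rintro ⟨a, ha⟩
  obtain ⟨α, π, hα, h⟩ := Quotient.exact ha
  have h : ∀ r, a r = x := fun r => by simpa [inducedNetwork_aut f hα] using congrFun h r
  refine ⟨⟨fun _ => f x, rfl⟩, fun r => ⟨Or.inr (Or.inl (by simp [h])), fun U hU => ?_⟩⟩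
  exact ⟨x, by simpa [h] using hU, rfl⟩

/-- The element of `Fin n`, up to the reordering `q`, that a configuration represents. -/
noncomputable def decode (f : Fin n → Fin n) (q : Fin n ≃ Fin n) :
    Config (orientedPath (2 * n)) 2 →. Config (inducedNetwork f) 1 := fun C =>
  ⟨∃ P, gridConfig P = C ∧ OnRoute g P.1 P.2,
    fun h => pointConfig f (q.symm (represented g h.choose.1 h.choose.2))⟩

variable {g}

theorem mem_decode {f : Fin n → Fin n} {q : Fin n ≃ Fin n} {P : Fin n × Fin n}
    (h : OnRoute g P.1 P.2) :
    pointConfig f (q.symm (represented g P.1 P.2)) ∈ decode g f q (gridConfig P) := by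
  have h' : ∃ Q, gridConfig Q = gridConfig P ∧ OnRoute g Q.1 Q.2 := ⟨P, rfl, h⟩
  refine ⟨h', ?_⟩
  have e : h'.choose = P := gridConfig_injective h'.choose_spec.1
  simp only [decode, e]

theorem routeAlgorithm_computes (f : Fin n → Fin n) (q : Fin n ≃ Fin n)
    (hq : NoncrossingOn Finset.univ (q ∘ f ∘ q.symm) id) :
    Computes (OP (2 * n) 2 one_le_two) (routeAlgorithm (q ∘ f ∘ q.symm)) f := by
  set g := q ∘ f ∘ q.symm with hg
  have hsemi : Semiconj q.symm g f := fun x => by simp [hg]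
  refine ⟨decode g f q, fun C' => ?_, fun E hE => ?_⟩
  · change Config (inducedNetwork f) 1 at C'
    obtain ⟨a, rfl⟩ := Quotient.exists_rep C'
    -- Diagonal points lie on the vertical part of their own route, so every element is represented.
    refine ⟨gridConfig (q (a 0), q (a 0)), ?_⟩
    have hroute : OnRoute g (q (a 0)) (q (a 0)) := Or.inr (by simp only [OnColumn]; omega)
    have : Quotient.mk _ a = pointConfig f (q.symm (represented g (q (a 0)) (q (a 0)))) := by
      simp only [represented, ite_self, Equiv.symm_apply_apply, pointConfig]
      congr 1
      funext r
      rw [Subsingleton.elim r 0]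
    exact this ▸ mem_decode hroute
  · change Execution (orientedPath (2 * n)) 2 at E
    by_cases h0 : (decode g f q (E 0)).Dom
    · obtain ⟨P₀, hP₀, hroute⟩ := h0
      let P : ℕ → Fin n × Fin n := fun i => Nat.rec P₀
        (fun _ Q => (nextColumn g Q.1 Q.2, nextRow g Q.1 Q.2)) i
      have hE' : ∀ i, E i = gridConfig (P i) := fun i => by
        induction i with
        | zero => exact hP₀.symm
        | succ i ih =>
          have := hE i
          rw [ih] at this
          exact routeAlgorithm_yields g this
      obtain ⟨σ, hmono, hsurj, hσ⟩ := routing_simulates hq P (fun _ => rfl) hroute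
      refine ⟨fun i => pointConfig f (f^[i] (q.symm (represented g P₀.1 P₀.2))), fun i => ?_,
        Or.inr ⟨σ, hmono, hsurj, fun i => ?_⟩⟩
      · simp only [iterate_succ_apply']
        exact functionAlgorithm_yields f _
      · change pointConfig f (f^[σ i] (q.symm (represented g P₀.1 P₀.2))) ∈ decode g f q (E i)
        rw [hE' i, ← (hsemi.iterate_right (σ i)).eq]
        have := mem_decode (f := f) (q := q) (hσ i).1
        rwa [(hσ i).2] at this
    -- Outside the domain of `decode` any execution for `f` will do, but one must exist; the robots'
    -- own positions rule out `n = 0`.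
    · by_cases hn : Nonempty (Fin n)
      · obtain ⟨x⟩ := hn
        refine ⟨fun i => pointConfig f (f^[i] x), fun i => ?_, Or.inl h0⟩
        simp only [iterate_succ_apply']
        exact functionAlgorithm_yields f _
      · obtain ⟨a, -⟩ := Quotient.exists_rep (E 0)
        exact (hn ⟨⟨0, by have := (a 0).2; omega⟩⟩).elim

end Robots

theorem mainTheorem2 (n : ℕ) (hn : 1 ≤ n) (f : Fin n → Fin n) :
    ∃ A : Robots.Algorithm (Robots.OP (2 * n) 2 one_le_two).G (Robots.OP (2 * n) 2 one_le_two).k,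
      A.IsSequential ∧ Robots.Computes (Robots.OP (2 * n) 2 one_le_two) A f := by
  obtain ⟨q, hq⟩ := Robots.exists_equiv_noncrossing f
  exact ⟨Robots.routeAlgorithm (q ∘ f ∘ q.symm), Robots.routeAlgorithm_isSequential _,
    Robots.routeAlgorithm_computes f q hq⟩
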